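/- Let $d,m\ge 1$ and let $v_1,\dots,v_m\in\mathbb{R}^d$ be pairwise orthogonal with respect to the Euclidean inner product, with lengths $|v_j|=l_j>0$ such that $\sum_{j=1}^m l_j=1$ (so necessarily $m\le d$). Let $\gamma:[0,1]\to\mathbb{R}^d$ be the piecewise linear path $\gamma=\gamma_{v_1}*\gamma_{v_2}*\cdots*\gamma_{v_m}$, the concatenation of the straight lines $\gamma_{v}(t)=tv$, $t\in[0,1]$. For $n\ge 0$ let $X^n\in(\mathbb{R}^d)^{\otimes n}$ be the $n$-th term of the signature of $\gamma$, that is, the tensor with coordinates $$X^{n;\,i_1,\dots,i_n}=\int_{0\le t_1\le\cdots\le t_n\le 1}d\gamma^{i_1}_{t_1}\cdots d\gamma^{i_n}_{t_n},\qquad i_1,\dots,i_n\in\{1,\dots,d\},$$ and let $\|\cdot\|$ be the Hilbert--Schmidt norm on $(\mathbb{R}^d)^{\otimes n}$, i.e. $\|A\|^2=\sum_{i_1,\dots,i_n}(A^{i_1,\dots,i_n})^2$. Then, as $n\to\infty$, $$\|n!\,X^n\|^2\;\sim\;2\sqrt{\pi n}\,\Bigl(\prod_{j=1}^m\frac{1}{4\pi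 n\,l_j}\Bigr)^{1/2},$$ meaning that the ratio of the two sides tends to $1$. -/

import Mathlib

noncomputable section

namespace PathSignature

/-- The straight line `γ_v : [0,1] → ℝ^d`, `γ_v(t) = t v`. -/
def linePath {d : ℕ} (v : EuclideanSpace ℝ (Fin d)) (t : ℝ) : EuclideanSpace ℝ (Fin d) :=
  t • v

/-- The concatenation `γ_1 * ⋯ * γ_m : [0,1] → ℝ^d` of paths `γ_j : [0,1] → ℝ^d`, where `γ_j` is
run on the `j`-th of the `m` equal subintervals of `[0,1]`. With `j : Fin m` counted from `0` and
`t ∈ [j/m, (j+1)/m]`, the terms of the sum with smaller index are the complete increments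
`γ_i(1) - γ_i(0)`, the term with index `j` is `γ_j(m t - j) - γ_j(0)`, and those with larger index
vanish. The path starts at the origin. -/
def concat {d m : ℕ} (γ : Fin m → ℝ → EuclideanSpace ℝ (Fin d)) (t : ℝ) :
    EuclideanSpace ℝ (Fin d) :=
  ∑ j : Fin m, (γ j (max 0 (min 1 ((m : ℝ) * t - ((j : ℕ) : ℝ)))) - γ j 0)

/-- The simplex `{a ≤ t_1 ≤ t_2 ≤ ⋯ ≤ t_n ≤ b}`. -/
def simplex (a b : ℝ) (n : ℕ) : Set (Fin n → ℝ) :=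
  {t | Monotone t ∧ ∀ j, t j ∈ Set.Icc a b}

/-- The `n`-th term of the signature over `[a,b]` of an absolutely continuous (for instance a
piecewise linear) path `γ`: the tensor in `(ℝ^d)^{⊗ n}` with the coordinates
`∫_{a ≤ t_1 ≤ ⋯ ≤ t_n ≤ b} dγ^{i_1}_{t_1} ⋯ dγ^{i_n}_{t_n}`, where `dγ^i_t = (γ^i)'(t) dt`.
The space `(ℝ^d)^{⊗ n}` with the Hilbert-Schmidt norm is the Euclidean space of the families
indexed by the words `(i_1, …, i_n)`. -/
def signatureTerm {d : ℕ} (γ : ℝ → EuclideanSpace ℝ (Fin d)) (a b : ℝ) (n : ℕ) :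
    EuclideanSpace ℝ (Fin n → Fin d) :=
  WithLp.toLp 2 fun i : Fin n → Fin d =>
    ∫ t in simplex a b n, ∏ j : Fin n, deriv (fun s : ℝ => γ s (i j)) (t j)

end PathSignature

end

open MeasureTheory

/-! On the `j`-th subinterval the path has constant velocity, so the signature is an explicit
combination of simple tensors: `n! X^n` is the sum over `k_1 + ⋯ + k_m = n` of the multinomial
coefficient of `k` times `v_1^{⊗k_1} ⊗ ⋯ ⊗ v_m^{⊗k_m}`. Orthogonality of the `v_j` makes these
tensors orthogonal, so the squared norm is the sum of the squares of the multinomial probabilities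
with weights `l_j` (`norm_sq_factorial_smul_signatureTerm`).

Write `m = M + 1`. By Parseval that sum is `(2π)^{-M}` times the integral over `[-π,π]^M` of `|∑ l_j
e^{iφ_j}|^{2n}`, with `φ_0 = 0` (`integral_phaseCube_one_sub_phaseGap_pow`). The integrand peaks at
the origin; after rescaling by `√n`, dominated convergence gives a Gaussian integral
(`tendsto_integral_phaseGap_pow`), which `integral_exp_neg_phaseForm` evaluates. -/

namespace PathSignature

/-! ### Cells of the simplex and their volumes -/

/-- The `j`-th of the `m` open subintervals of `[0,1]` of length `1/m`. -/
def cell {m : ℕ} (j : Fin m) : Set ℝ := Set.Ioo ((j : ℝ) / m) (((j : ℝ) + 1) / m)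

/-- The part of the open simplex on which the `j`-th time lies in the cell numbered `c j`. -/
def cellSimplex {m n : ℕ} (c : Fin n → Fin m) : Set (Fin n → ℝ) :=
  {t | StrictMono t ∧ ∀ j, t j ∈ cell (c j)}

theorem measurableSet_strictMono (n : ℕ) : MeasurableSet {t : Fin n → ℝ | StrictMono t} := by
  have : {t : Fin n → ℝ | StrictMono t} = ⋂ (a : Fin n) (b : Fin n) (_ : a < b),
      {t : Fin n → ℝ | t a < t b} := by
    ext t; simp [StrictMono]
  rw [this]
  refine MeasurableSet.iInter fun a => MeasurableSet.iInter fun b => MeasurableSet.iInter fun _ =>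
    measurableSet_lt (measurable_pi_apply a) (measurable_pi_apply b)

theorem measurableSet_cellSimplex {m n : ℕ} (c : Fin n → Fin m) :
    MeasurableSet (cellSimplex c) := by
  refine (measurableSet_strictMono n).inter ?_
  have : {t : Fin n → ℝ | ∀ j, t j ∈ cell (c j)} = Set.pi Set.univ fun j => cell (c j) := by
    ext t; simp
  change MeasurableSet {t : Fin n → ℝ | ∀ j, t j ∈ cell (c j)}
  rw [this]
  exact MeasurableSet.univ_pi fun j => measurableSet_Ioo

theorem cell_eq_of_mem {m : ℕ} {i j : Fin m} {x : ℝ} (hi : x ∈ cell i) (hj : x ∈ cell j) :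
    i = j := by
  have hm : (0 : ℝ) < m := by
    have := i.pos
    exact_mod_cast this
  simp only [cell, Set.mem_Ioo, div_lt_iff₀ hm, lt_div_iff₀ hm] at hi hj
  have h1 : ((i : ℕ) : ℝ) < ((j : ℕ) : ℝ) + 1 := hi.1.trans hj.2
  have h2 : ((j : ℕ) : ℝ) < ((i : ℕ) : ℝ) + 1 := hj.1.trans hi.2
  have h1' : (i : ℕ) < j + 1 := by exact_mod_cast h1
  have h2' : (j : ℕ) < i + 1 := by exact_mod_cast h2
  ext; omega

theorem cell_le_of_lt {m : ℕ} {i j : Fin m} {x y : ℝ} (hi : x ∈ cell i) (hj : y ∈ cell j)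
    (hxy : x < y) : i ≤ j := by
  have hm : (0 : ℝ) < m := by
    have := i.pos
    exact_mod_cast this
  simp only [cell, Set.mem_Ioo, div_lt_iff₀ hm, lt_div_iff₀ hm] at hi hj
  have h1 : ((i : ℕ) : ℝ) < ((j : ℕ) : ℝ) + 1 :=
    hi.1.trans ((mul_lt_mul_of_pos_right hxy hm).trans hj.2)
  have h1' : (i : ℕ) < j + 1 := by exact_mod_cast h1
  rw [Fin.le_def]; omega

theorem cellSimplex_eq_empty {m n : ℕ} {c : Fin n → Fin m} (hc : ¬ Monotone c) :
    cellSimplex c = ∅ := by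
  refine Set.eq_empty_iff_forall_notMem.2 fun t ht => hc (monotone_iff_forall_lt.2 ?_)
  exact fun a b hab => cell_le_of_lt (ht.2 a) (ht.2 b) (ht.1 hab)

theorem cell_subset_Icc {m : ℕ} (j : Fin m) : cell j ⊆ Set.Icc 0 1 := by
  have hm : (0 : ℝ) < m := by
    have := j.pos
    exact_mod_cast this
  intro x hx
  simp only [cell, Set.mem_Ioo, div_lt_iff₀ hm, lt_div_iff₀ hm] at hx
  have h1 : ((j : ℕ) : ℝ) + 1 ≤ m := by exact_mod_cast j.2
  have h0 : (0 : ℝ) ≤ ((j : ℕ) : ℝ) := by positivity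
  constructor
  · by_contra! h
    nlinarith
  · by_contra! h
    nlinarith

theorem exists_mem_cell {m : ℕ} (hm : 0 < m) {x : ℝ} (hx : x ∈ Set.Icc (0 : ℝ) 1)
    (hgrid : x ∉ Set.range fun k : ℕ => (k : ℝ) / m) : ∃ j : Fin m, x ∈ cell j := by
  have hm' : (0 : ℝ) < m := by exact_mod_cast hm
  have hne : ∀ k : ℕ, (k : ℝ) ≠ x * m := fun k hk => hgrid ⟨k, by
    simp only [hk]; field_simp⟩
  have h0 : 0 ≤ x * m := by have := hx.1; positivity
  have h1 : x * m < m := lt_of_le_of_ne (by nlinarith [hx.2]) (hne m).symm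
  refine ⟨⟨⌊x * m⌋₊, (Nat.floor_lt h0).2 h1⟩, ?_⟩
  simp only [cell, Set.mem_Ioo, div_lt_iff₀ hm', lt_div_iff₀ hm']
  exact ⟨lt_of_le_of_ne (Nat.floor_le h0) (hne _), Nat.lt_floor_add_one _⟩

theorem ae_forall_notMem_of_countable (n : ℕ) {s : Set ℝ} (hs : s.Countable) :
    ∀ᵐ t : Fin n → ℝ, ∀ j, t j ∉ s := by
  refine ae_all_iff.2 fun j => ?_
  exact (Measure.quasiMeasurePreserving_eval (fun _ : Fin n => (volume : Measure ℝ)) j).ae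
    (measure_eq_zero_iff_ae_notMem.1 (hs.measure_zero volume))

/-- Each diagonal `t a = t b` is a proper subspace, hence null. This makes weakly and strictly
increasing times interchangeable under the integral. -/
theorem ae_injective (n : ℕ) : ∀ᵐ t : Fin n → ℝ, Function.Injective t := by
  have h : ∀ a b : Fin n, a ≠ b → ∀ᵐ t : Fin n → ℝ, t a ≠ t b := by
    intro a b hab
    let p : Submodule ℝ (Fin n → ℝ) :=
      LinearMap.ker (LinearMap.proj (R := ℝ) (φ := fun _ : Fin n => ℝ) a - LinearMap.proj b)
    have hp : p ≠ ⊤ := by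
      intro htop
      have : Pi.single a (1 : ℝ) ∈ p := htop ▸ Submodule.mem_top
      simp [p, hab.symm] at this
    have := Measure.addHaar_submodule (volume : Measure (Fin n → ℝ)) p hp
    filter_upwards [measure_eq_zero_iff_ae_notMem.1 this] with t ht heq
    exact ht (by simp [p, heq])
  have h' : ∀ᵐ t : Fin n → ℝ, ∀ a b : Fin n, a ≠ b → t a ≠ t b :=
    ae_all_iff.2 fun a => ae_all_iff.2 fun b => by
      by_cases hab : a = b
      · simp [hab]
      · filter_upwards [h a b hab] with t ht _ using ht
  filter_upwards [h'] with t ht a b hab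
  by_contra hne
  exact ht a b hne hab

theorem measurePreserving_comp_perm {n : ℕ} (σ : Equiv.Perm (Fin n)) :
    MeasurePreserving (fun t : Fin n → ℝ => t ∘ σ) := by
  exact (volume_measurePreserving_piCongrLeft (fun _ : Fin n => ℝ) σ).symm

theorem volume_cell {m : ℕ} (j : Fin m) : volume (cell j) = ENNReal.ofReal (1 / m) := by
  rw [cell, Real.volume_Ioo]
  congr 1
  ring

theorem volume_cellSimplex_ne_top {m n : ℕ} (c : Fin n → Fin m) :
    volume (cellSimplex c) ≠ ⊤ := by
  refine ne_top_of_le_ne_top ?_ (measure_mono (t := Set.pi Set.univ fun j => cell (c j)) ?_)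
  · rw [volume_pi_pi]
    exact ENNReal.prod_ne_top fun j _ => by simp [volume_cell]
  · exact fun t ht j _ => ht.2 j

/-- Up to a null set, the box `∏ cell (c j)` splits according to the permutation that sorts `t`, and
sorting preserves measure. -/
theorem sum_perm_volume_cellSimplex {m n : ℕ} (c : Fin n → Fin m) :
    ∑ σ : Equiv.Perm (Fin n), volume.real (cellSimplex (c ∘ σ)) = (1 / m : ℝ) ^ n := by
  let E : Equiv.Perm (Fin n) → Set (Fin n → ℝ) := fun σ =>
    (fun t : Fin n → ℝ => t ∘ σ) ⁻¹' cellSimplex (c ∘ σ)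
  have hE : ∀ σ, MeasurableSet (E σ) := fun σ =>
    (measurePreserving_comp_perm σ).measurable (measurableSet_cellSimplex _)
  have hvol : ∀ σ, volume (E σ) = volume (cellSimplex (c ∘ σ)) := fun σ =>
    (measurePreserving_comp_perm σ).measure_preimage (measurableSet_cellSimplex _).nullMeasurableSet
  have hmem : ∀ σ t, t ∈ E σ ↔ StrictMono (t ∘ σ) ∧ ∀ j, t j ∈ cell (c j) := by
    intro σ t
    refine and_congr Iff.rfl ⟨fun h j => ?_, fun h j => h (σ j)⟩
    simpa using h (σ.symm j)
  have hdisj : Pairwise (Function.onFun Disjoint E) := by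
    intro σ τ hστ
    refine Set.disjoint_left.2 fun t h1 h2 => hστ ?_
    rw [hmem] at h1 h2
    have := Tuple.unique_monotone h1.1.monotone h2.1.monotone
    have hinj : Function.Injective t := by
      have := h1.1.injective
      rwa [σ.injective_comp] at this
    exact Equiv.ext fun j => hinj (congrFun this j)
  have hunion : (⋃ σ, E σ) =ᵐ[volume] Set.pi Set.univ fun j => cell (c j) := by
    filter_upwards [ae_injective n] with t ht
    refine propext ?_
    change t ∈ (⋃ σ, E σ) ↔ t ∈ Set.pi Set.univ fun j => cell (c j)
    simp only [Set.mem_iUnion, hmem, Set.mem_univ_pi]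
    refine ⟨fun ⟨σ, h⟩ => h.2, fun h => ⟨Tuple.sort t, ?_, h⟩⟩
    exact (Tuple.monotone_sort t).strictMono_of_injective (ht.comp (Equiv.injective _))
  have hsum : ∑ σ, volume (E σ) = ENNReal.ofReal (1 / m) ^ n := by
    rw [← tsum_fintype (L := .unconditional _), ← measure_iUnion hdisj hE, measure_congr hunion, volume_pi_pi]
    simp [volume_cell]
  calc ∑ σ : Equiv.Perm (Fin n), volume.real (cellSimplex (c ∘ σ))
      = (∑ σ, volume (E σ)).toReal := by
        rw [ENNReal.toReal_sum fun σ _ => by rw [hvol]; exact volume_cellSimplex_ne_top _]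
        simp [Measure.real, hvol]
    _ = (1 / m : ℝ) ^ n := by
        rw [hsum, ENNReal.toReal_pow, ENNReal.toReal_ofReal (by positivity)]

/-- The number of occurrences of the letter `j` in the word `c`. -/
def letterCount {m n : ℕ} (c : Fin n → Fin m) (j : Fin m) : ℕ :=
  Fintype.card {i // c i = j}

/-- In the sum over permutations only monotone `c ∘ σ` contribute, and a monotone rearrangement of
`c` is `c` itself. The surviving terms are equal, and their number is the order of the stabilizer of
`c`. -/
theorem volume_cellSimplex_of_monotone {m n : ℕ} {c : Fin n → Fin m} (hc : Monotone c) :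
    volume.real (cellSimplex c) = (1 / m : ℝ) ^ n / ∏ j, ((letterCount c j).factorial : ℝ) := by
  have h := sum_perm_volume_cellSimplex c
  have hterm : ∀ σ : Equiv.Perm (Fin n), volume.real (cellSimplex (c ∘ σ)) =
      if c ∘ σ = c then volume.real (cellSimplex c) else 0 := by
    intro σ
    split_ifs with hσ
    · rw [hσ]
    · rw [cellSimplex_eq_empty, measureReal_empty]
      exact fun hm => hσ (Tuple.unique_monotone hm (τ := 1) hc)
  have hcard : ((Finset.univ.filter fun σ : Equiv.Perm (Fin n) => c ∘ σ = c).card : ℝ) =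
      ∏ j, ((letterCount c j).factorial : ℝ) := by
    rw [← Fintype.card_subtype, DomMulAct.stabilizer_card]
    simp [letterCount]
  rw [Finset.sum_congr rfl fun σ _ => hterm σ, ← Finset.sum_filter, Finset.sum_const, nsmul_eq_mul,
    hcard] at h
  rw [eq_div_iff (by positivity), mul_comm, h]

/-! ### Signature coordinates of the polygonal path -/

/-- While piece `c` is being run, the clamped clocks of earlier pieces are frozen at `1` and those
of later pieces at `0`. -/
theorem hasDerivAt_clamp {m : ℕ} (c j : Fin m) {x : ℝ} (hx : x ∈ cell c) :
    HasDerivAt (fun s : ℝ => max 0 (min 1 ((m : ℝ) * s - ((j : ℕ) : ℝ))))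
      (if j = c then (m : ℝ) else 0) x := by
  have hm : (0 : ℝ) < m := by
    have := c.pos
    exact_mod_cast this
  have hnhds : ∀ᶠ s in nhds x, s ∈ cell c := isOpen_Ioo.mem_nhds hx
  have hcell : ∀ s, s ∈ cell c ↔ ((c : ℕ) : ℝ) < m * s ∧ m * s < ((c : ℕ) : ℝ) + 1 := by
    intro s
    simp only [cell, Set.mem_Ioo, div_lt_iff₀ hm, lt_div_iff₀ hm, mul_comm s]
  rcases lt_trichotomy j c with h | h | h
  · rw [if_neg h.ne]
    have hjc : ((j : ℕ) : ℝ) + 1 ≤ ((c : ℕ) : ℝ) := by exact_mod_cast Fin.lt_def.1 h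
    refine (hasDerivAt_const x (1 : ℝ)).congr_of_eventuallyEq ?_
    filter_upwards [hnhds] with s hs
    rw [hcell] at hs
    rw [min_eq_left (by linarith [hs.1]), max_eq_right zero_le_one]
  · rw [if_pos h]
    subst h
    have : HasDerivAt (fun s : ℝ => (m : ℝ) * s - ((j : ℕ) : ℝ)) m x := by
      simpa using ((hasDerivAt_id x).const_mul (m : ℝ)).sub_const ((j : ℕ) : ℝ)
    refine this.congr_of_eventuallyEq ?_
    filter_upwards [hnhds] with s hs
    rw [hcell] at hs
    rw [min_eq_right (by linarith [hs.2]), max_eq_right (by linarith [hs.1])]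
  · rw [if_neg h.ne']
    have hjc : ((c : ℕ) : ℝ) + 1 ≤ ((j : ℕ) : ℝ) := by exact_mod_cast Fin.lt_def.1 h
    refine (hasDerivAt_const x (0 : ℝ)).congr_of_eventuallyEq ?_
    filter_upwards [hnhds] with s hs
    rw [hcell] at hs
    exact max_eq_left ((min_le_right _ _).trans (by linarith [hs.2]))

theorem deriv_concat_linePath {d m : ℕ} (v : Fin m → EuclideanSpace ℝ (Fin d)) (c : Fin m)
    (i : Fin d) {x : ℝ} (hx : x ∈ cell c) :
    deriv (fun s : ℝ => concat (fun j => linePath (v j)) s i) x = m * v c i := by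
  have h : HasDerivAt (fun s : ℝ => ∑ j : Fin m,
      max 0 (min 1 ((m : ℝ) * s - ((j : ℕ) : ℝ))) * v j i)
      (∑ j : Fin m, (if j = c then (m : ℝ) else 0) * v j i) x :=
    HasDerivAt.fun_sum fun j _ => (hasDerivAt_clamp c j hx).mul_const (v j i)
  have heq : (fun s : ℝ => concat (fun j => linePath (v j)) s i) =
      fun s : ℝ => ∑ j : Fin m, max 0 (min 1 ((m : ℝ) * s - ((j : ℕ) : ℝ))) * v j i := by
    funext s
    simp [concat, linePath]
  rw [heq, h.deriv]
  simp

theorem pairwise_disjoint_cellSimplex {m n : ℕ} :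
    Pairwise (Function.onFun Disjoint (cellSimplex : (Fin n → Fin m) → Set (Fin n → ℝ))) := by
  intro c c' hne
  refine Set.disjoint_left.2 fun t h h' => hne (funext fun j => ?_)
  exact cell_eq_of_mem (h.2 j) (h'.2 j)

theorem simplex_ae_eq_iUnion_cellSimplex {m : ℕ} (hm : 0 < m) (n : ℕ) :
    simplex 0 1 n =ᵐ[volume] ⋃ c : Fin n → Fin m, cellSimplex c := by
  filter_upwards [ae_injective n, ae_forall_notMem_of_countable n
    (Set.countable_range fun k : ℕ => (k : ℝ) / m)] with t ht hgrid
  refine propext ?_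
  change t ∈ simplex 0 1 n ↔ t ∈ ⋃ c : Fin n → Fin m, cellSimplex c
  rw [Set.mem_iUnion]
  constructor
  · rintro ⟨hmono, hIcc⟩
    choose c hc using fun j => exists_mem_cell hm (hIcc j) (hgrid j)
    exact ⟨c, hmono.strictMono_of_injective ht, hc⟩
  · rintro ⟨c, hmono, hc⟩
    exact ⟨hmono.monotone, fun j => cell_subset_Icc _ (hc j)⟩

theorem signatureTerm_concat_linePath_apply {d m : ℕ} (hm : 0 < m)
    (v : Fin m → EuclideanSpace ℝ (Fin d)) (n : ℕ) (i : Fin n → Fin d) :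
    signatureTerm (concat fun j => linePath (v j)) 0 1 n i =
      ∑ c : Fin n → Fin m, (volume.real (cellSimplex c) * (m : ℝ) ^ n) *
        ∏ j, v (c j) (i j) := by
  have hval : ∀ c : Fin n → Fin m, Set.EqOn
      (fun t : Fin n → ℝ => ∏ j : Fin n,
        deriv (fun s : ℝ => concat (fun j => linePath (v j)) s (i j)) (t j))
      (fun _ => (m : ℝ) ^ n * ∏ j, v (c j) (i j)) (cellSimplex c) := by
    intro c t ht
    simp only
    rw [Finset.prod_congr rfl fun j _ => deriv_concat_linePath v (c j) (i j) (ht.2 j),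
      Finset.prod_mul_distrib]
    simp
  change ∫ t in simplex 0 1 n, ∏ j : Fin n,
    deriv (fun s : ℝ => concat (fun j => linePath (v j)) s (i j)) (t j) = _
  rw [setIntegral_congr_set (simplex_ae_eq_iUnion_cellSimplex hm n),
    integral_iUnion_fintype measurableSet_cellSimplex pairwise_disjoint_cellSimplex]
  · refine Finset.sum_congr rfl fun c _ => ?_
    rw [setIntegral_congr_fun (measurableSet_cellSimplex c) (hval c), setIntegral_const,
      smul_eq_mul, mul_assoc]
  · intro c
    rw [integrableOn_congr_fun (hval c) (measurableSet_cellSimplex c)]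
    exact integrableOn_const (volume_cellSimplex_ne_top c)

/-! ### Letter counts and the Hilbert-Schmidt norm -/

theorem sum_letterCount {m n : ℕ} (c : Fin n → Fin m) : ∑ j, letterCount c j = n := by
  simp only [letterCount]
  rw [← Fintype.card_sigma, Fintype.card_congr (Equiv.sigmaFiberEquiv c), Fintype.card_fin]

theorem prod_comp_eq_prod_pow_letterCount {m n : ℕ} (c : Fin n → Fin m) (f : Fin m → ℝ) :
    ∏ i, f (c i) = ∏ j, f j ^ letterCount c j := by
  rw [← Fintype.prod_fiberwise' c f]
  simp [letterCount]

/-- The speed factor `m ^ n` cancels the cell lengths, so the parametrization leaves no trace. -/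
theorem factorial_mul_volume_cellSimplex {m n : ℕ} (hm : 0 < m) (c : Fin n → Fin m)
    [Decidable (Monotone c)] :
    (n.factorial : ℝ) * (volume.real (cellSimplex c) * (m : ℝ) ^ n) =
      if Monotone c then (Nat.multinomial Finset.univ (letterCount c) : ℝ) else 0 := by
  have hm' : (m : ℝ) ≠ 0 := by positivity
  split_ifs with hc
  · have hspec := Nat.multinomial_spec Finset.univ (letterCount c)
    rw [sum_letterCount] at hspec
    have hpos : (∏ j, ((letterCount c j).factorial : ℝ)) ≠ 0 := by positivity
    rw [volume_cellSimplex_of_monotone hc, ← hspec]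
    push_cast
    field_simp
    rw [mul_assoc, ← mul_pow, one_div_mul_cancel hm', one_pow, mul_one]
  · rw [cellSimplex_eq_empty hc]
    simp

/-- A monotone word is the sorted form of its multiset of letters, so it corresponds to exactly one
count vector. -/
theorem sum_monotone_letterCount {m n : ℕ} (F : (Fin m → ℕ) → ℝ)
    [DecidablePred fun c : Fin n → Fin m => Monotone c] :
    ∑ c : Fin n → Fin m with Monotone c, F (letterCount c) =
      ∑ k ∈ Finset.piAntidiag Finset.univ n, F k := by
  refine Finset.sum_nbij letterCount ?_ ?_ ?_ fun _ _ => rfl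
  · intro c _
    simp [Finset.mem_piAntidiag, sum_letterCount]
  · intro c hc c' hc' h
    have hc : Monotone c := by simpa using hc
    have hc' : Monotone c' := by simpa using hc'
    -- Fibres of equal size glue to a permutation carrying `c'` to `c`; two monotone rearrangements
    -- of one word coincide.
    have e : ∀ j, {i // c i = j} ≃ {i // c' i = j} := fun j =>
      Fintype.equivOfCardEq (congrFun h j)
    have hcomp : c' ∘ Equiv.ofFiberEquiv e = c := funext fun i => Equiv.ofFiberEquiv_map e i
    have := Tuple.unique_monotone (f := c') (σ := Equiv.ofFiberEquiv e) (τ := 1)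
      (by rwa [hcomp]) hc'
    rw [hcomp] at this
    exact this
  · intro k hk
    have hk : ∑ j, k j = n := by simpa [Finset.mem_piAntidiag] using hk
    have e : Fin n ≃ Σ j, Fin (k j) := Fintype.equivOfCardEq (by simp [hk])
    let w : Fin n → Fin m := fun i => (e i).1
    have hw : letterCount w = k := by
      funext j
      calc letterCount w j = Fintype.card {x : Σ j, Fin (k j) // x.1 = j} :=
            Fintype.card_congr (e.subtypeEquiv fun _ => Iff.rfl)
        _ = Fintype.card (Fin (k j)) := Fintype.card_congr (Equiv.sigmaSubtype j)
        _ = k j := Fintype.card_fin _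
    refine ⟨w ∘ Tuple.sort w, by simpa using Tuple.monotone_sort w, ?_⟩
    rw [← hw]
    funext j
    exact Fintype.card_congr ((Tuple.sort w).subtypeEquiv fun _ => Iff.rfl)

/-- The inner product of two simple tensors is the product of the inner products of their factors,
so distinct words give orthogonal tensors. -/
theorem sum_sq_sum_tensor {d m n : ℕ} (v : Fin m → EuclideanSpace ℝ (Fin d)) (l : Fin m → ℝ)
    (horth : Pairwise fun i j => inner ℝ (v i) (v j) = 0) (hnorm : ∀ j, ‖v j‖ = l j)
    (B : (Fin n → Fin m) → ℝ) :
    ∑ i : Fin n → Fin d, (∑ c, B c * ∏ j, v (c j) (i j)) ^ 2 =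
      ∑ c, B c ^ 2 * ∏ j, l (c j) ^ 2 := by
  have hinner : ∀ c c' : Fin n → Fin m,
      ∑ i : Fin n → Fin d, (∏ j, v (c j) (i j)) * ∏ j, v (c' j) (i j) =
        if c = c' then ∏ j, l (c j) ^ 2 else 0 := by
    intro c c'
    have h1 : ∑ i : Fin n → Fin d, (∏ j, v (c j) (i j)) * ∏ j, v (c' j) (i j) =
        ∏ j, inner ℝ (v (c' j)) (v (c j)) := by
      simp only [← Finset.prod_mul_distrib, PiLp.inner_apply, Finset.prod_univ_sum,
        Fintype.piFinset_univ, RCLike.inner_apply, conj_trivial]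
    rw [h1]
    split_ifs with h
    · subst h
      simp [hnorm]
    · obtain ⟨j, hj⟩ := Function.ne_iff.1 h
      exact Finset.prod_eq_zero (Finset.mem_univ j) (horth hj.symm)
  calc ∑ i : Fin n → Fin d, (∑ c, B c * ∏ j, v (c j) (i j)) ^ 2
      = ∑ c, ∑ c', B c * B c' *
          ∑ i : Fin n → Fin d, (∏ j, v (c j) (i j)) * ∏ j, v (c' j) (i j) := by
        simp only [sq, Finset.sum_mul_sum]
        simp only [Finset.mul_sum]
        rw [Finset.sum_comm]
        refine Finset.sum_congr rfl fun c _ => ?_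
        rw [Finset.sum_comm]
        exact Finset.sum_congr rfl fun c' _ => Finset.sum_congr rfl fun i _ => by ring
    _ = _ := by
        simp only [hinner, mul_ite, mul_zero, Finset.sum_ite_eq, Finset.mem_univ, if_true, sq]

theorem norm_sq_factorial_smul_signatureTerm {d m : ℕ} (hm : 0 < m)
    (v : Fin m → EuclideanSpace ℝ (Fin d)) (l : Fin m → ℝ)
    (horth : Pairwise fun i j => inner ℝ (v i) (v j) = 0) (hnorm : ∀ j, ‖v j‖ = l j) (n : ℕ) :
    ‖(n.factorial : ℝ) • signatureTerm (concat fun j => linePath (v j)) 0 1 n‖ ^ 2 =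
      ∑ k ∈ Finset.piAntidiag Finset.univ n,
        ((Nat.multinomial Finset.univ k : ℝ) * ∏ j, l j ^ k j) ^ 2 := by
  classical
  rw [EuclideanSpace.real_norm_sq_eq]
  have hcoord : ∀ i : Fin n → Fin d,
      ((n.factorial : ℝ) • signatureTerm (concat fun j => linePath (v j)) 0 1 n) i =
        ∑ c : Fin n → Fin m,
          (if Monotone c then (Nat.multinomial Finset.univ (letterCount c) : ℝ) else 0) *
            ∏ j, v (c j) (i j) := by
    intro i
    rw [PiLp.smul_apply, smul_eq_mul, signatureTerm_concat_linePath_apply hm, Finset.mul_sum]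
    refine Finset.sum_congr rfl fun c _ => ?_
    rw [← mul_assoc, factorial_mul_volume_cellSimplex hm]
  simp only [hcoord]
  rw [sum_sq_sum_tensor v l horth hnorm, ← sum_monotone_letterCount fun k =>
    ((Nat.multinomial Finset.univ k : ℝ) * ∏ j, l j ^ k j) ^ 2, Finset.sum_filter]
  refine Finset.sum_congr rfl fun c _ => ?_
  split_ifs
  · rw [mul_pow, ← prod_comp_eq_prod_pow_letterCount c l, Finset.prod_pow]
  · simp

/-! ### Fourier representation of the sum of squares -/

/-- The gap `1 - |∑ l_j e^{i φ_j}|²` for weights `l` of total mass `1`. -/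
noncomputable def phaseGap {m : ℕ} (l φ : Fin m → ℝ) : ℝ :=
  ∑ j, ∑ k, l j * l k * (1 - Real.cos (φ j - φ k))

theorem exp_sum_mul_conj_eq_one_sub_phaseGap {m : ℕ} (l φ : Fin m → ℝ) (hsum : ∑ j, l j = 1) :
    (∑ j, (l j : ℂ) * Complex.exp (φ j * Complex.I)) *
      (∑ j, (l j : ℂ) * Complex.exp (-(φ j * Complex.I))) = ((1 - phaseGap l φ : ℝ) : ℂ) := by
  have hterm : ∀ a b : ℝ, Complex.exp (a * Complex.I) * Complex.exp (-(b * Complex.I)) +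
      Complex.exp (b * Complex.I) * Complex.exp (-(a * Complex.I)) =
        2 * (Real.cos (a - b) : ℂ) := by
    intro a b
    rw [← Complex.exp_add, ← Complex.exp_add, Complex.ofReal_cos, Complex.two_cos]
    push_cast
    congr 2 <;> ring
  have hgap : ((1 - phaseGap l φ : ℝ) : ℂ) =
      ∑ j, ∑ k, (l j : ℂ) * l k * (Real.cos (φ j - φ k) : ℂ) := by
    have h1 : ∑ j, ∑ k, l j * l k = 1 := by
      rw [← Finset.sum_mul_sum, hsum, one_mul]
    have : 1 - phaseGap l φ = ∑ j, ∑ k, l j * l k * Real.cos (φ j - φ k) := by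
      simp only [phaseGap, mul_sub, mul_one, Finset.sum_sub_distrib, h1]
      ring
    rw [this]
    push_cast
    rfl
  -- Symmetrizing in `(j, k)` pairs each exponential with its conjugate, which produces the cosines.
  have hdouble : ∀ f : Fin m → Fin m → ℂ, 2 * ∑ j, ∑ k, f j k = ∑ j, ∑ k, (f j k + f k j) := by
    intro f
    simp only [Finset.sum_add_distrib]
    rw [Finset.sum_comm (f := fun j k => f k j)]
    ring
  rw [hgap, Finset.sum_mul_sum]
  refine mul_left_cancel₀ (two_ne_zero (α := ℂ)) ?_
  rw [hdouble, Finset.mul_sum]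
  refine Finset.sum_congr rfl fun j _ => ?_
  rw [Finset.mul_sum]
  refine Finset.sum_congr rfl fun k _ => ?_
  linear_combination (l j : ℂ) * l k * hterm (φ j) (φ k)

theorem one_sub_phaseGap_nonneg {m : ℕ} (l φ : Fin m → ℝ) (hsum : ∑ j, l j = 1) :
    0 ≤ 1 - phaseGap l φ := by
  have h := exp_sum_mul_conj_eq_one_sub_phaseGap l φ hsum
  have hconj : (∑ j, (l j : ℂ) * Complex.exp (-(φ j * Complex.I))) =
      (starRingEnd ℂ) (∑ j, (l j : ℂ) * Complex.exp (φ j * Complex.I)) := by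
    simp [map_sum, ← Complex.exp_conj]
  rw [hconj, Complex.mul_conj] at h
  rw [← Complex.ofReal_injective h]
  exact Complex.normSq_nonneg _

theorem continuous_phaseGap {m : ℕ} (l : Fin m → ℝ) : Continuous (phaseGap l) := by
  unfold phaseGap
  fun_prop

theorem continuous_cons_zero (M : ℕ) :
    Continuous fun θ : Fin M → ℝ => (Fin.cons 0 θ : Fin (M + 1) → ℝ) := by
  refine continuous_pi fun j => ?_
  refine Fin.cases ?_ (fun k => ?_) j
  · simpa using continuous_const
  · simpa using continuous_apply k

theorem integral_exp_int_mul_I (k : ℤ) :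
    ∫ θ in Set.Icc (-Real.pi) Real.pi, Complex.exp (k * (θ * Complex.I)) =
      if k = 0 then (2 * Real.pi : ℂ) else 0 := by
  rw [integral_Icc_eq_integral_Ioc,
    ← intervalIntegral.integral_of_le (by linarith [Real.pi_pos])]
  split_ifs with hk
  · subst hk
    simp
    ring
  · have hc : (k : ℂ) * Complex.I ≠ 0 := by simp [hk]
    have h := integral_exp_mul_complex (a := -Real.pi) (b := Real.pi) hc
    rw [show (fun θ : ℝ => Complex.exp (k * (θ * Complex.I))) =
      fun θ : ℝ => Complex.exp (k * Complex.I * θ) by funext θ; ring_nf, h]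
    have : Complex.exp (k * Complex.I * (Real.pi : ℝ)) =
        Complex.exp (k * Complex.I * ((-Real.pi : ℝ) : ℂ)) := by
      rw [Complex.exp_eq_exp_iff_exists_int]
      exact ⟨k, by push_cast; ring⟩
    rw [this, sub_self, zero_div]

/-- The cube `[-π, π]^M`. -/
def phaseCube (M : ℕ) : Set (Fin M → ℝ) := Set.pi Set.univ fun _ => Set.Icc (-Real.pi) Real.pi

theorem isCompact_phaseCube (M : ℕ) : IsCompact (phaseCube M) :=
  isCompact_univ_pi fun _ => isCompact_Icc

theorem integral_phaseCube_prod_exp {M : ℕ} (a : Fin M → ℤ) :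
    ∫ θ in phaseCube M, ∏ j, Complex.exp (a j * (θ j * Complex.I)) =
      if a = 0 then (2 * Real.pi : ℂ) ^ M else 0 := by
  rw [phaseCube, volume_pi, Measure.restrict_pi_pi,
    integral_fintype_prod_eq_prod (fun j (x : ℝ) => Complex.exp (a j * (x * Complex.I)))]
  simp only [integral_exp_int_mul_I]
  split_ifs with h
  · subst h
    simp
  · obtain ⟨j, hj⟩ := Function.ne_iff.1 h
    exact Finset.prod_eq_zero (Finset.mem_univ j) (if_neg hj)

/-- The values `ε = 1` and `ε = -1` give the two conjugate factors of the squared modulus. -/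
theorem exp_sum_pow {M : ℕ} (l : Fin (M + 1) → ℝ) (θ : Fin M → ℝ) (ε : ℂ) (n : ℕ) :
    (∑ j, (l j : ℂ) *
      Complex.exp (ε * (((Fin.cons 0 θ : Fin (M + 1) → ℝ) j : ℝ) * Complex.I))) ^ n =
      ∑ k ∈ Finset.piAntidiag Finset.univ n,
        ((Nat.multinomial Finset.univ k * ∏ j, l j ^ k j : ℝ) : ℂ) *
          ∏ j : Fin M, Complex.exp (k j.succ * (ε * (θ j * Complex.I))) := by
  rw [Finset.sum_pow_eq_sum_piAntidiag]
  refine Finset.sum_congr rfl fun k _ => ?_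
  simp only [mul_pow, Finset.prod_mul_distrib]
  rw [Fin.prod_univ_succ (fun j => Complex.exp _ ^ k j)]
  simp [← Complex.exp_nat_mul, mul_assoc]

/-- Parseval's identity for the trigonometric polynomial `(l_0 + ∑ l_j e^{iθ_j})^n`: only the
diagonal pairs `k = k'` survive integration. -/
theorem integral_phaseCube_one_sub_phaseGap_pow {M : ℕ} (l : Fin (M + 1) → ℝ)
    (hsum : ∑ j, l j = 1) (n : ℕ) :
    ∫ θ in phaseCube M, (1 - phaseGap l (Fin.cons 0 θ)) ^ n =
      (2 * Real.pi) ^ M * ∑ k ∈ Finset.piAntidiag Finset.univ n,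
        ((Nat.multinomial Finset.univ k : ℝ) * ∏ j, l j ^ k j) ^ 2 := by
  refine Complex.ofReal_injective ?_
  set A : (Fin (M + 1) → ℕ) → ℝ := fun k => Nat.multinomial Finset.univ k * ∏ j, l j ^ k j with hA
  have hexpand : ∀ θ : Fin M → ℝ, (((1 - phaseGap l (Fin.cons 0 θ)) ^ n : ℝ) : ℂ) =
      ∑ k ∈ Finset.piAntidiag Finset.univ n, ∑ k' ∈ Finset.piAntidiag Finset.univ n,
        ((A k * A k' : ℝ) : ℂ) * ∏ j : Fin M,
          Complex.exp ((((k j.succ : ℤ) - (k' j.succ : ℤ) : ℤ) : ℂ) * (θ j * Complex.I)) := by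
    intro θ
    rw [Complex.ofReal_pow, ← exp_sum_mul_conj_eq_one_sub_phaseGap l _ hsum, mul_pow]
    have h1 := exp_sum_pow l θ 1 n
    have h2 := exp_sum_pow l θ (-1) n
    simp only [one_mul] at h1
    simp only [neg_mul, one_mul] at h2
    rw [h1, h2, Finset.sum_mul_sum]
    refine Finset.sum_congr rfl fun k _ => Finset.sum_congr rfl fun k' _ => ?_
    have hprod : ∏ j : Fin M, Complex.exp
        ((((k j.succ : ℤ) - (k' j.succ : ℤ) : ℤ) : ℂ) * (θ j * Complex.I)) =
        (∏ j : Fin M, Complex.exp (k j.succ * (θ j * Complex.I))) *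
          ∏ j : Fin M, Complex.exp (k' j.succ * -(θ j * Complex.I)) := by
      rw [← Finset.prod_mul_distrib]
      refine Finset.prod_congr rfl fun j _ => ?_
      rw [← Complex.exp_add]
      push_cast
      ring_nf
    rw [hprod, Complex.ofReal_mul (A k) (A k')]
    exact mul_mul_mul_comm _ _ _ _
  have hint : ∀ (b : ℂ) (a : Fin M → ℤ), IntegrableOn (fun θ : Fin M → ℝ =>
      b * ∏ j : Fin M, Complex.exp ((a j : ℂ) * (θ j * Complex.I))) (phaseCube M) := by
    intro b a
    refine ContinuousOn.integrableOn_compact (isCompact_phaseCube M) (Continuous.continuousOn ?_)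
    fun_prop
  rw [← integral_complex_ofReal]
  simp only [hexpand]
  rw [integral_finsetSum _ fun k _ => integrable_finsetSum _ fun k' _ => hint _ _]
  push_cast
  rw [Finset.mul_sum]
  refine Finset.sum_congr rfl fun k hk => ?_
  rw [integral_finsetSum _ fun k' _ => by exact_mod_cast hint _ fun j => (k j.succ : ℤ) - k' j.succ]
  have hk : ∑ j, k j = n := by simpa [Finset.mem_piAntidiag] using hk
  rw [Finset.sum_eq_single k]
  · have := integral_phaseCube_prod_exp (fun j : Fin M => (k j.succ : ℤ) - k j.succ)
    push_cast at this
    rw [integral_const_mul, this, if_pos (by ext j; simp)]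
    simp only [hA]
    push_cast
    ring
  · intro k' hk' hne
    have hk' : ∑ j, k' j = n := by simpa [Finset.mem_piAntidiag] using hk'
    have := integral_phaseCube_prod_exp (fun j : Fin M => (k j.succ : ℤ) - k' j.succ)
    push_cast at this
    rw [integral_const_mul, this, if_neg, mul_zero]
    intro h
    have htail : ∀ j : Fin M, k j.succ = k' j.succ := fun j => by
      have := congrFun h j
      simp only [Pi.zero_apply] at this
      omega
    -- The Fourier mode sees only the entries of `k` past the first; the total `n` recovers `k 0`.
    refine hne (funext fun j => ?_)
    rw [Fin.sum_univ_succ] at hk hk'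
    simp only [htail] at hk
    refine Fin.cases ?_ (fun i => (htail i).symm) j
    omega
  · intro h
    exact absurd (by simp [Finset.mem_piAntidiag, hk]) h

/-! ### Laplace's method -/

/-- The quadratic form to which `n * phaseGap l (x / √n)` converges. -/
noncomputable def phaseForm {m : ℕ} (l φ : Fin m → ℝ) : ℝ :=
  ∑ j, ∑ k, l j * l k * ((φ j - φ k) ^ 2 / 2)

theorem tendsto_natCast_mul_one_sub_cos (y : ℝ) :
    Filter.Tendsto (fun n : ℕ => (n : ℝ) * (1 - Real.cos ((√(n : ℝ))⁻¹ * y))) Filter.atTop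
      (nhds (y ^ 2 / 2)) := by
  have hsqrt : Filter.Tendsto (fun n : ℕ => (√(n : ℝ))⁻¹) Filter.atTop (nhds 0) :=
    (Real.tendsto_sqrt_atTop.comp tendsto_natCast_atTop_atTop).inv_tendsto_atTop
  have hu : Filter.Tendsto (fun n : ℕ => (√(n : ℝ))⁻¹ * y / 2) Filter.atTop (nhds 0) := by
    simpa using (hsqrt.mul_const y).div_const 2
  -- With `u` half the angle, `1 - cos 2u = 2 sin² u = 2 u² sinc² u`, and `n u² = y² / 4` is
  -- constant.
  have hs : Filter.Tendsto (fun n : ℕ => y ^ 2 / 2 * Real.sinc ((√(n : ℝ))⁻¹ * y / 2) ^ 2)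
      Filter.atTop (nhds (y ^ 2 / 2)) := by
    have := ((Real.continuous_sinc.tendsto 0).comp hu).pow 2
    simpa using this.const_mul (y ^ 2 / 2)
  refine hs.congr' ?_
  filter_upwards [Filter.eventually_gt_atTop 0] with n hn
  have hn' : (0 : ℝ) < n := by exact_mod_cast hn
  set u := (√(n : ℝ))⁻¹ * y / 2 with hu_def
  have h2u : (√(n : ℝ))⁻¹ * y = 2 * u := by rw [hu_def]; ring
  have hsin : Real.sin u = u * Real.sinc u := by
    by_cases h : u = 0
    · simp [h]
    · rw [Real.sinc_of_ne_zero h, mul_div_cancel₀ _ h]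
  have husq : (n : ℝ) * u ^ 2 = y ^ 2 / 4 := by
    rw [hu_def, div_pow, mul_pow, inv_pow, Real.sq_sqrt hn'.le]
    field_simp
    norm_num
  rw [h2u, Real.cos_two_mul, Real.cos_sq', hsin]
  linear_combination (-2 * Real.sinc u ^ 2) * husq

theorem tendsto_natCast_mul_phaseGap {m : ℕ} (l φ : Fin m → ℝ) :
    Filter.Tendsto (fun n : ℕ => (n : ℝ) * phaseGap l ((√(n : ℝ))⁻¹ • φ)) Filter.atTop
      (nhds (phaseForm l φ)) := by
  have h : Filter.Tendsto (fun n : ℕ => ∑ j, ∑ k, l j * l k *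
      ((n : ℝ) * (1 - Real.cos ((√(n : ℝ))⁻¹ * (φ j - φ k))))) Filter.atTop
      (nhds (phaseForm l φ)) :=
    tendsto_finsetSum _ fun j _ => tendsto_finsetSum _ fun k _ =>
      (tendsto_natCast_mul_one_sub_cos _).const_mul _
  refine h.congr fun n => ?_
  simp only [phaseGap, Finset.mul_sum, Pi.smul_apply, smul_eq_mul, mul_sub]
  refine Finset.sum_congr rfl fun j _ => Finset.sum_congr rfl fun k _ => ?_
  ring

theorem cons_zero_smul {M : ℕ} (r : ℝ) (x : Fin M → ℝ) :
    (Fin.cons 0 (r • x) : Fin (M + 1) → ℝ) = r • (Fin.cons 0 x : Fin (M + 1) → ℝ) := by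
  funext j
  refine Fin.cases ?_ (fun k => ?_) j <;> simp

/-- This supplies the Gaussian majorant. Row `j = 0` suffices: its differences are `-θ_k`, which
stay in `[-π, π]`, where `cos θ ≤ 1 - 2θ²/π²`. Other differences may leave that range, but their
terms are nonnegative. -/
theorem sum_sq_le_phaseGap {M : ℕ} {l : Fin (M + 1) → ℝ} (hpos : ∀ j, 0 < l j) {θ : Fin M → ℝ}
    (hθ : θ ∈ phaseCube M) :
    ∑ k : Fin M, l 0 * l k.succ * (2 / Real.pi ^ 2) * θ k ^ 2 ≤ phaseGap l (Fin.cons 0 θ) := by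
  have hterm : ∀ (φ : Fin (M + 1) → ℝ) j k, 0 ≤ l j * l k * (1 - Real.cos (φ j - φ k)) :=
    fun φ j k => mul_nonneg (mul_pos (hpos j) (hpos k)).le (by linarith [Real.cos_le_one (φ j - φ k)])
  have hrow : ∑ k, l 0 * l k * (1 - Real.cos
      ((Fin.cons 0 θ : Fin (M + 1) → ℝ) 0 - (Fin.cons 0 θ : Fin (M + 1) → ℝ) k)) ≤
        phaseGap l (Fin.cons 0 θ) :=
    Finset.single_le_sum (f := fun j => ∑ k, l j * l k * (1 - Real.cos
      ((Fin.cons 0 θ : Fin (M + 1) → ℝ) j - (Fin.cons 0 θ : Fin (M + 1) → ℝ) k)))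
      (fun j _ => Finset.sum_nonneg fun k _ => hterm _ j k) (Finset.mem_univ 0)
  refine le_trans ?_ hrow
  rw [Fin.sum_univ_succ]
  refine le_add_of_nonneg_of_le (hterm _ 0 0) (Finset.sum_le_sum fun k _ => ?_)
  have hk : |θ k| ≤ Real.pi := abs_le.2 (hθ k (Set.mem_univ k))
  have hcos := Real.cos_le_one_sub_mul_cos_sq hk
  simp only [Fin.cons_zero, Fin.cons_succ, zero_sub, Real.cos_neg]
  rw [mul_assoc]
  exact mul_le_mul_of_nonneg_left (by linarith) (mul_pos (hpos 0) (hpos k.succ)).le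

theorem integrable_exp_neg_sum_mul_sq {M : ℕ} {c : Fin M → ℝ} (hc : ∀ k, 0 < c k) :
    Integrable fun x : Fin M → ℝ => Real.exp (-∑ k, c k * x k ^ 2) := by
  have h : (fun x : Fin M → ℝ => Real.exp (-∑ k, c k * x k ^ 2)) =
      fun x => ∏ k, Real.exp (-c k * x k ^ 2) := by
    funext x
    rw [← Finset.sum_neg_distrib, Real.exp_sum]
    simp
  rw [h]
  exact Integrable.fintype_prod fun k => integrable_exp_neg_mul_sq (hc k)

theorem integral_exp_neg_sum_mul_sq {M : ℕ} (c : Fin M → ℝ) :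
    ∫ x : Fin M → ℝ, Real.exp (-∑ k, c k * x k ^ 2) = ∏ k, √(Real.pi / c k) := by
  have h : (fun x : Fin M → ℝ => Real.exp (-∑ k, c k * x k ^ 2)) =
      fun x => ∏ k, Real.exp (-c k * x k ^ 2) := by
    funext x
    rw [← Finset.sum_neg_distrib, Real.exp_sum]
    simp
  rw [h, integral_fintype_prod_volume_eq_prod fun k (x : ℝ) => Real.exp (-c k * x ^ 2)]
  simp only [integral_gaussian]

theorem tendsto_integral_phaseGap_pow {M : ℕ} {l : Fin (M + 1) → ℝ} (hpos : ∀ j, 0 < l j)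
    (hsum : ∑ j, l j = 1) :
    Filter.Tendsto (fun n : ℕ => √(n : ℝ) ^ M *
        ∫ θ in phaseCube M, (1 - phaseGap l (Fin.cons 0 θ)) ^ n) Filter.atTop
      (nhds (∫ x : Fin M → ℝ, Real.exp (-phaseForm l (Fin.cons 0 x)))) := by
  have hcube : MeasurableSet (phaseCube M) := (isCompact_phaseCube M).measurableSet
  have hcont : Continuous fun θ : Fin M → ℝ => 1 - phaseGap l (Fin.cons 0 θ) :=
    continuous_const.sub ((continuous_phaseGap l).comp (continuous_cons_zero M))
  let f : ℕ → (Fin M → ℝ) → ℝ := fun n =>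
    (phaseCube M).indicator fun θ => (1 - phaseGap l (Fin.cons 0 θ)) ^ n
  have hf : ∀ n, Measurable (f n) := fun n => (hcont.pow n).measurable.indicator hcube
  let c : Fin M → ℝ := fun k => l 0 * l k.succ * (2 / Real.pi ^ 2)
  have hc : ∀ k, 0 < c k := fun k => by
    have := hpos 0; have := hpos k.succ; have := Real.pi_pos; positivity
  have hlim : Filter.Tendsto (fun n : ℕ => ∫ x : Fin M → ℝ, f n ((√(n : ℝ))⁻¹ • x)) Filter.atTop
      (nhds (∫ x : Fin M → ℝ, Real.exp (-phaseForm l (Fin.cons 0 x)))) := by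
    refine tendsto_integral_filter_of_dominated_convergence
      (fun x => Real.exp (-∑ k, c k * x k ^ 2)) ?_ ?_ (integrable_exp_neg_sum_mul_sq hc) ?_
    · exact Filter.Eventually.of_forall fun n =>
        ((hf n).comp (measurable_const_smul _)).aestronglyMeasurable
    · filter_upwards [Filter.eventually_gt_atTop 0] with n hn
      refine Filter.Eventually.of_forall fun x => ?_
      have hn' : (0 : ℝ) < n := by exact_mod_cast hn
      by_cases hx : (√(n : ℝ))⁻¹ • x ∈ phaseCube M
      · have h0 := one_sub_phaseGap_nonneg l (Fin.cons 0 ((√(n : ℝ))⁻¹ • x)) hsum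
        have hle := sum_sq_le_phaseGap hpos hx
        simp only [f, Set.indicator_of_mem hx]
        rw [Real.norm_of_nonneg (pow_nonneg h0 n)]
        calc (1 - phaseGap l (Fin.cons 0 ((√(n : ℝ))⁻¹ • x))) ^ n
            ≤ Real.exp (-phaseGap l (Fin.cons 0 ((√(n : ℝ))⁻¹ • x))) ^ n :=
              pow_le_pow_left₀ h0 (Real.one_sub_le_exp_neg _) n
          _ = Real.exp (-(n * phaseGap l (Fin.cons 0 ((√(n : ℝ))⁻¹ • x)))) := by
              rw [← Real.exp_nat_mul, mul_neg]
          _ ≤ Real.exp (-∑ k, c k * x k ^ 2) := by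
              refine Real.exp_le_exp.2 (neg_le_neg ?_)
              refine le_trans (le_of_eq ?_) (mul_le_mul_of_nonneg_left hle hn'.le)
              rw [Finset.mul_sum]
              refine Finset.sum_congr rfl fun k _ => ?_
              simp only [Pi.smul_apply, smul_eq_mul, mul_pow, inv_pow, Real.sq_sqrt hn'.le, c]
              field_simp
      · simp only [f, Set.indicator_of_notMem hx, norm_zero]
        positivity
    · refine Filter.Eventually.of_forall fun x => ?_
      have hsqrt : Filter.Tendsto (fun n : ℕ => (√(n : ℝ))⁻¹) Filter.atTop (nhds 0) :=
        (Real.tendsto_sqrt_atTop.comp tendsto_natCast_atTop_atTop).inv_tendsto_atTop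
      have hsmul : Filter.Tendsto (fun n : ℕ => (√(n : ℝ))⁻¹ • x) Filter.atTop (nhds 0) := by
        simpa using hsqrt.smul_const x
      -- Each fixed `x` is eventually inside the rescaled cube, so the indicator does not affect the
      -- pointwise limit.
      have hnhds : phaseCube M ∈ nhds (0 : Fin M → ℝ) :=
        set_pi_mem_nhds Set.finite_univ fun _ _ =>
          Icc_mem_nhds (by simpa using Real.pi_pos) (by simpa using Real.pi_pos)
      have hpow : Filter.Tendsto (fun n : ℕ =>
          (1 + -phaseGap l (Fin.cons 0 ((√(n : ℝ))⁻¹ • x))) ^ n) Filter.atTop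
          (nhds (Real.exp (-phaseForm l (Fin.cons 0 x)))) := by
        refine Real.tendsto_one_add_pow_exp_of_tendsto ?_
        simp only [cons_zero_smul, mul_neg]
        exact (tendsto_natCast_mul_phaseGap l (Fin.cons 0 x)).neg
      refine hpow.congr' ?_
      filter_upwards [hsmul.eventually_mem hnhds] with n hn
      simp only [f, Set.indicator_of_mem hn, sub_eq_add_neg]
  refine hlim.congr' ?_
  filter_upwards [Filter.eventually_gt_atTop 0] with n hn
  have hn' : (0 : ℝ) < √(n : ℝ) := Real.sqrt_pos.2 (by exact_mod_cast hn)
  -- The Jacobian of `θ = x / √n` produces the factor `√n ^ M`.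
  rw [Measure.integral_comp_smul_of_nonneg _ _ _ (hR := by positivity), integral_indicator hcube]
  simp

/-! ### The Gaussian integral -/

/-- `phaseForm` is the variance of `φ` under the weights `l`, and the second moment of `φ + s` is
this variance plus the squared mean. -/
theorem phaseForm_add_sq {M : ℕ} (l : Fin (M + 1) → ℝ) (hsum : ∑ j, l j = 1) (x : Fin M → ℝ)
    (s : ℝ) :
    phaseForm l (Fin.cons 0 x) + (s + ∑ k : Fin M, l k.succ * x k) ^ 2 =
      l 0 * s ^ 2 + ∑ k : Fin M, l k.succ * (x k + s) ^ 2 := by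
  set φ : Fin (M + 1) → ℝ := Fin.cons 0 x with hφ
  have hlin : ∑ k : Fin M, l k.succ * x k = ∑ j, l j * φ j := by
    rw [Fin.sum_univ_succ (fun j => l j * φ j)]
    simp [hφ]
  have hsq : l 0 * s ^ 2 + ∑ k : Fin M, l k.succ * (x k + s) ^ 2 = ∑ j, l j * (φ j + s) ^ 2 := by
    rw [Fin.sum_univ_succ (fun j => l j * (φ j + s) ^ 2)]
    simp [hφ]
  have hform : phaseForm l φ = ∑ j, l j * φ j ^ 2 - (∑ j, l j * φ j) ^ 2 := by
    have : phaseForm l φ = ∑ j, ∑ k, (l j * φ j ^ 2 * l k / 2 + l j * (l k * φ k ^ 2) / 2 -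
        (l j * φ j) * (l k * φ k)) :=
      Finset.sum_congr rfl fun j _ => Finset.sum_congr rfl fun k _ => by ring
    rw [this]
    simp only [Finset.sum_sub_distrib, Finset.sum_add_distrib, ← Finset.sum_div,
      ← Finset.mul_sum, ← Finset.sum_mul, hsum]
    ring
  have hexp : ∑ j, l j * (φ j + s) ^ 2 =
      ∑ j, l j * φ j ^ 2 + 2 * s * ∑ j, l j * φ j + s ^ 2 := by
    have : ∑ j, l j * (φ j + s) ^ 2 = ∑ j, (l j * φ j ^ 2 + 2 * s * (l j * φ j) + l j * s ^ 2) :=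
      Finset.sum_congr rfl fun j _ => by ring
    rw [this]
    simp only [Finset.sum_add_distrib, ← Finset.mul_sum, ← Finset.sum_mul, hsum]
    ring
  rw [hlin, hsq, hform, hexp]
  ring

/-- An auxiliary variable `s` replaces a determinant computation. The Gaussian `F` is integrated in
both orders: over `x` first, a shift by `s` decouples all variables; over `s` first, a shift by the
mean splits off `√π`. -/
theorem integral_exp_neg_phaseForm {M : ℕ} {l : Fin (M + 1) → ℝ} (hpos : ∀ j, 0 < l j)
    (hsum : ∑ j, l j = 1) :
    √Real.pi * ∫ x : Fin M → ℝ, Real.exp (-phaseForm l (Fin.cons 0 x)) =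
      ∏ j, √(Real.pi / l j) := by
  let F : ℝ → (Fin M → ℝ) → ℝ := fun s x =>
    Real.exp (-(l 0 * s ^ 2 + ∑ k : Fin M, l k.succ * (x k + s) ^ 2))
  have hF : ∀ s x, F s x = Real.exp (-l 0 * s ^ 2) *
      Real.exp (-∑ k : Fin M, l k.succ * ((x + fun _ => s : Fin M → ℝ) k) ^ 2) := by
    intro s x
    rw [← Real.exp_add]
    simp only [F, Pi.add_apply]
    ring_nf
  have hF' : ∀ s x, F s x = Real.exp (-phaseForm l (Fin.cons 0 x)) *
      Real.exp (-1 * (s + ∑ k : Fin M, l k.succ * x k) ^ 2) := by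
    intro s x
    rw [← Real.exp_add]
    simp only [F, ← phaseForm_add_sq l hsum x s]
    ring_nf
  have hFcont : Continuous (Function.uncurry F) := by
    simp only [F, Function.uncurry_def]
    fun_prop
  have hinner : ∀ s, ∫ x, F s x = Real.exp (-l 0 * s ^ 2) * ∏ k : Fin M, √(Real.pi / l k.succ) := by
    intro s
    simp only [hF]
    rw [integral_const_mul, integral_add_right_eq_self
      (fun x : Fin M → ℝ => Real.exp (-∑ k : Fin M, l k.succ * x k ^ 2)),
      integral_exp_neg_sum_mul_sq fun k : Fin M => l k.succ]
  have hint : Integrable (Function.uncurry F) (volume.prod volume) := by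
    rw [integrable_prod_iff hFcont.aestronglyMeasurable]
    constructor
    · refine Filter.Eventually.of_forall fun s => ?_
      simp only [Function.uncurry_apply_pair, hF]
      exact ((integrable_exp_neg_sum_mul_sq fun k : Fin M => hpos k.succ).comp_add_right
        (fun _ => s)).const_mul _
    · have hnorm : ∀ s x, ‖F s x‖ = F s x := fun s x => Real.norm_of_nonneg (Real.exp_pos _).le
      simp only [Function.uncurry_apply_pair, hnorm, hinner]
      exact (integrable_exp_neg_mul_sq (hpos 0)).mul_const _
  have hswap := integral_integral_swap hint
  simp only [hinner] at hswap
  rw [integral_mul_const, integral_gaussian] at hswap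
  rw [Fin.prod_univ_succ, hswap, ← integral_const_mul]
  refine integral_congr_ae (Filter.Eventually.of_forall fun x => ?_)
  simp only [hF']
  rw [integral_const_mul, integral_add_right_eq_self (fun s : ℝ => Real.exp (-1 * s ^ 2)),
    integral_gaussian, div_one, mul_comm]

/-! ### Matching constants and conclusion -/

/-- Each of the `M + 1` factors contributes `(2π√n)⁻¹`; the prefactor `2√(πn)` cancels one of them
up to `1 / √π`. -/
theorem two_mul_sqrt_mul_prod_rpow_eq {M n : ℕ} (hn : 0 < n) {l : Fin (M + 1) → ℝ}
    (hpos : ∀ j, 0 < l j) :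
    2 * √(Real.pi * n) * (∏ j, 1 / (4 * Real.pi * n * l j)) ^ (1 / 2 : ℝ) =
      (∏ j, √(Real.pi / l j)) / √Real.pi / ((2 * Real.pi) ^ M * √(n : ℝ) ^ M) := by
  have hn' : (0 : ℝ) < n := by exact_mod_cast hn
  have hpi := Real.pi_pos
  have hfactor : ∀ j, √(1 / (4 * Real.pi * n * l j)) =
      (2 * Real.pi * √(n : ℝ))⁻¹ * √(Real.pi / l j) := by
    intro j
    have hl := hpos j
    rw [show 1 / (4 * Real.pi * n * l j) =
      ((2 * Real.pi * √(n : ℝ))⁻¹) ^ 2 * (Real.pi / l j) by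
        rw [inv_pow, mul_pow, mul_pow, Real.sq_sqrt hn'.le]; field_simp; norm_num,
      Real.sqrt_mul (sq_nonneg _), Real.sqrt_sq (by positivity)]
  rw [← Real.sqrt_eq_rpow, Real.sqrt_prod _ fun j _ => by have := hpos j; positivity]
  simp only [hfactor, Finset.prod_mul_distrib, Finset.prod_const, Finset.card_univ,
    Fintype.card_fin]
  rw [Real.sqrt_mul hpi.le]
  have hs : (0 : ℝ) < √Real.pi := Real.sqrt_pos.2 hpi
  have hsn : (0 : ℝ) < √(n : ℝ) := Real.sqrt_pos.2 hn'
  have hss : √Real.pi * √Real.pi = Real.pi := Real.mul_self_sqrt hpi.le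
  rw [inv_pow, mul_pow, pow_succ, pow_succ, eq_div_iff (by positivity), eq_div_iff (by positivity)]
  field_simp
  linear_combination (∏ j, √(Real.pi / l j)) * hss

theorem isEquivalent_sum_sq_multinomial {M : ℕ} {l : Fin (M + 1) → ℝ} (hpos : ∀ j, 0 < l j)
    (hsum : ∑ j, l j = 1) :
    Asymptotics.IsEquivalent Filter.atTop
      (fun n : ℕ => ∑ k ∈ Finset.piAntidiag Finset.univ n,
        ((Nat.multinomial Finset.univ k : ℝ) * ∏ j, l j ^ k j) ^ 2)
      (fun n : ℕ => 2 * √(Real.pi * (n : ℝ)) *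
        (∏ j, 1 / (4 * Real.pi * (n : ℝ) * l j)) ^ (1 / 2 : ℝ)) := by
  set G := ∫ x : Fin M → ℝ, Real.exp (-phaseForm l (Fin.cons 0 x)) with hG
  have hgauss := integral_exp_neg_phaseForm hpos hsum
  have hs : (0 : ℝ) < √Real.pi := Real.sqrt_pos.2 Real.pi_pos
  have hprod : 0 < ∏ j, √(Real.pi / l j) := Finset.prod_pos fun j _ =>
    Real.sqrt_pos.2 (div_pos Real.pi_pos (hpos j))
  have hGeq : G = (∏ j, √(Real.pi / l j)) / √Real.pi := by
    rw [eq_div_iff hs.ne', mul_comm, hgauss]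
  have hGne : G ≠ 0 := by rw [hGeq]; positivity
  have hlim := (Asymptotics.isEquivalent_const_iff_tendsto hGne).2
    (tendsto_integral_phaseGap_pow hpos hsum)
  have hdiv := hlim.div (Asymptotics.IsEquivalent.refl
    (u := fun n : ℕ => (2 * Real.pi) ^ M * √(n : ℝ) ^ M))
  refine (hdiv.congr_left ?_).congr_right ?_
  · filter_upwards [Filter.eventually_gt_atTop 0] with n hn
    have hn' : (0 : ℝ) < √(n : ℝ) := Real.sqrt_pos.2 (by exact_mod_cast hn)
    have := Real.pi_pos
    simp only [Pi.div_apply]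
    rw [integral_phaseCube_one_sub_phaseGap_pow l hsum]
    field_simp
  · filter_upwards [Filter.eventually_gt_atTop 0] with n hn
    rw [two_mul_sqrt_mul_prod_rpow_eq hn hpos, ← hGeq]
    rfl

end PathSignature

theorem mainTheorem11 {d m : ℕ} (v : Fin m → EuclideanSpace ℝ (Fin d)) (l : Fin m → ℝ)
    (horth : Pairwise fun i j => inner ℝ (v i) (v j) = 0)
    (hnorm : ∀ j, ‖v j‖ = l j) (hpos : ∀ j, 0 < l j) (hsum : ∑ j, l j = 1) :
    Asymptotics.IsEquivalent Filter.atTop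
      (fun n : ℕ => ‖(Nat.factorial n : ℝ) •
        PathSignature.signatureTerm
          (PathSignature.concat fun j => PathSignature.linePath (v j)) 0 1 n‖ ^ 2)
      (fun n : ℕ => 2 * Real.sqrt (Real.pi * (n : ℝ)) *
        (∏ j, 1 / (4 * Real.pi * (n : ℝ) * l j)) ^ (1 / 2 : ℝ)) := by
  obtain _ | M := m
  -- For `m = 0` the lengths would sum to `0`, not `1`.
  · simp at hsum
  · simp only [PathSignature.norm_sq_factorial_smul_signatureTerm M.succ_pos v l horth hnorm]
    exact PathSignature.isEquivalent_sum_sq_multinomial hpos hsum
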